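/- Let $n\ge 1$ be an integer. For a field $K$ and $a\in K^\times$ put $K_a=K[t]/(t^n-a)$. For a number field $K$ with ring of integers $\mathcal O_K$, let $\Delta(K_a/K)$ be the discriminant of the $K$-algebra $K_a$, that is, the ideal of $\mathcal O_K$ generated by $\det(\mathrm{Tr}_{K_a/K}(b_ib_j))_{i,j}$ for all $K$-bases $(b_i)$ of $K_a$ consisting of elements integral over $\mathcal O_K$. For a finite place $v$ of $K$ let $\mathfrak p_v$ be the corresponding prime ideal of $\mathcal O_K$ and $v(\cdot)$ the normalized valuation; write $v\mid n$ if $n\in\mathfrak p_v$, and $v\mid a$ if $v(a)\neq 0$. (1) For every number field $K$ there are a positive constant $C_{K,n}$, depending only on $K$ and $n$, and integers $e(a,v)$ with $0\le e(a,v)\le C_{K,n}$ for all $a\in K^\times$ and $v\mid n$, such that for all $a\in K^\times$ $$\Delta(K_a/K)=\prod_{v\nmid n,\ v\mid a}\mathfrak p_v^{\,n-\gcd(v(a),n)}\ \prod_{v\mid n}\mathfrak p_v^{\,e(a,v)}.$$ (2) For $K=\mathbb Q$ there are a positive constant $C_n$ and integers $0\le e(a,p)\le C_n$, for $a\in\mathbb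 Z\setminus\{0\}$ and primes $p\mid n$, such that for every nonzero $a\in\mathbb Z$ coprime to $n$ the following equalities of ideals of $\mathbb Z$ hold: $$\Delta(\mathbb Q_a/\mathbb Q)=\prod_{p\mid a}p^{\,n-\gcd(v_p(a),n)}\prod_{p\mid n}p^{\,e(a,p)},$$ and, if $a$ is squarefree, $$\Delta(\mathbb Q_a/\mathbb Q)=a^{n-1}\prod_{p\mid n}p^{\,e(a,p)}.$$ Moreover, if $a$ is squarefree, coprime to $n$, and $a\neq\pm1$, then $\mathbb Q_a$ is a field. -/

import Mathlib

open Polynomial IsDedekindDomain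
open scoped NumberField

noncomputable section

/-- The `K`-algebra `K_a = K[t]/(t^n - a)`. -/
abbrev kummerAlgebra (K : Type*) [Field K] (n : ℕ) (a : K) : Type _ :=
  AdjoinRoot (X ^ n - C a : K[X])

/-- The discriminant `Δ(L/K)` of a finite-dimensional commutative `K`-algebra `L`, with respect to
a subring of integers `A` of `K`: the ideal of `A` generated by the discriminants
`det (Tr_{L/K} (b i * b j))` of all `K`-bases `b` of `L` consisting of elements integral
over `A`. -/
def discrIdeal (A K L : Type*) [CommRing A] [Field K] [CommRing L] [Algebra A K] [Algebra K L]
    [Algebra A L] : Ideal A :=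
  Ideal.span {d : A | ∃ b : Module.Basis (Fin (Module.finrank K L)) K L,
    (∀ i, IsIntegral A (b i)) ∧ algebraMap A K d = Algebra.discr K b}

/-- The normalized additive valuation `v(x) ∈ ℤ` of `x ∈ Kˣ` at a finite place `v` of `K`.
Mathlib's multiplicative valuation of `x` is `exp (-v(x))`. -/
def placeOrd {K : Type*} [Field K] [NumberField K] (v : HeightOneSpectrum (𝓞 K)) (x : Kˣ) : ℤ :=
  -WithZero.log (v.valuation K (x : K))

end

/-! The powers of `t` form a basis of discriminant `± n ^ n * a ^ (n - 1)`; put `m = v(a)`. If `x =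
∑ c_k t ^ k` is integral, Fourier inversion over the maps `t ↦ ζ ^ j * β` shows that `(n * c_k) ^ n
* a ^ k` is integral (`isIntegral_of_kummerBasis_repr`). For `v ∤ n` this gives `v(c_k) ≥ -⌊k m /
n⌋`, so every integral basis has discriminant of valuation at least `(n - 1) m - 2 ∑ ⌊k m / n⌋ = n -
gcd(m, n)`.

Conversely, at any `v`, suitable multiples `c_k t ^ k` with `v(c_k) = -⌊k m / n⌋` form an integral
basis whose discriminant has valuation `n - gcd(m, n) + n v(n)`
(`exists_mem_discrIdeal_kummerAlgebra`). The exponent is therefore exact when `v ∤ n` and bounded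
independently of `a` at the finitely many `v ∣ n`. Over `ℚ` places become primes, and Eisenstein's
criterion gives irreducibility. -/

/-- Pair `i + 1` with `n - (i + 1)`: the two floors add up to `m - 1`, or to `m` when `n ∣ (i + 1)
m`, which happens for `gcd(m, n)` indices. -/
theorem two_mul_sum_mul_ediv (n : ℕ) (hn : 0 < n) (m : ℤ) :
    2 * ∑ i : Fin n, ((i : ℕ) * m) / (n : ℤ) = (n - 1) * m - (n - Int.gcd m n) := by
  rw [Fin.sum_univ_eq_sum_range (fun i : ℕ => ((i : ℤ) * m) / (n : ℤ)) n]
  have hn' : (n : ℤ) ≠ 0 := by exact_mod_cast hn.ne'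
  have hpair : ∀ i ∈ Finset.range n, ((i + 1 : ℕ) * m) / (n : ℤ) +
      ((n - 1 - i : ℕ) * m) / (n : ℤ) = m - 1 + if n ∣ (i + 1) * m.natAbs then 1 else 0 := by
    intro i hi
    have hi' : i < n := Finset.mem_range.1 hi
    have h1 : (((n - 1 - i : ℕ) : ℤ)) = n - (i + 1) := by omega
    have h2 : n ∣ (i + 1) * m.natAbs ↔ (n : ℤ) ∣ (i + 1) * m := by
      rw [← Int.natCast_dvd_natCast]
      push_cast
      rw [← dvd_abs (n : ℤ) (((i : ℤ) + 1) * m), abs_mul,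
        abs_of_nonneg (by positivity : (0 : ℤ) ≤ (i : ℤ) + 1)]
    rw [h1]
    push_cast
    have h3 : ((n : ℤ) - (i + 1)) * m = -((i + 1) * m) + m * n := by ring
    rw [h3, Int.add_mul_ediv_right _ _ hn', Int.neg_ediv,
      Int.sign_eq_one_of_pos (by exact_mod_cast hn)]
    simp only [h2]
    split_ifs <;> ring
  have hcard : ((Finset.range n).filter (fun i => n ∣ (i + 1) * m.natAbs)).card =
      Int.gcd m n := by
    have hd : 0 < Nat.gcd m.natAbs n := Nat.gcd_pos_of_pos_right _ hn
    have h : ∀ i, n ∣ (i + 1) * m.natAbs ↔ n / Nat.gcd m.natAbs n ∣ i + 1 := by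
      intro i
      rw [Nat.div_dvd_iff_dvd_mul (Nat.gcd_dvd_right _ _) hd, mul_comm _ (i + 1), Nat.gcd_comm,
        Nat.dvd_mul_gcd_iff_dvd_mul]
    simp only [h]
    rw [Nat.card_multiples, Nat.div_div_self (Nat.gcd_dvd_right _ _) hn.ne']
    rfl
  have h := Finset.sum_congr rfl hpair
  rw [Finset.sum_add_distrib, Finset.sum_range_reflect (fun i : ℕ => ((i : ℤ) * m) / (n : ℤ)) n,
    Finset.sum_add_distrib, Finset.sum_boole, hcard, Finset.sum_const, Finset.card_range] at h
  -- The pairing sums one copy over `1, …, n` instead of `0, …, n - 1`; the shift adds the end term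
  -- `m`.
  have hs := Finset.sum_range_succ' (fun i : ℕ => ((i : ℤ) * m) / (n : ℤ)) n
  rw [Finset.sum_range_succ, Int.mul_ediv_cancel_left _ hn'] at hs
  simp only [Nat.cast_zero, zero_mul, Int.zero_ediv, add_zero] at hs
  simp only [nsmul_eq_mul] at h
  have e : ((n : ℤ) - 1) * m = n * (m - 1) + n - m := by ring
  rw [e]
  linarith

/-! ### The power basis, its traces and its discriminant -/

noncomputable section

/-- The basis `1, t, …, t ^ (n - 1)` of `K[t]/(t ^ n - a)`. -/
def kummerBasis (K : Type*) [Field K] (n : ℕ) (hn : 0 < n) (a : K) :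
    Module.Basis (Fin n) K (kummerAlgebra K n a) :=
  (AdjoinRoot.powerBasis' (monic_X_pow_sub_C a hn.ne')).basis.reindex
    (finCongr (natDegree_X_pow_sub_C (n := n) (r := a)))

variable {K : Type*} [Field K] {n : ℕ}

theorem kummerBasis_apply (hn : 0 < n) (a : K) (i : Fin n) :
    kummerBasis K n hn a i = AdjoinRoot.root (X ^ n - C a) ^ (i : ℕ) := by
  simp [kummerBasis]
  rfl

theorem finrank_kummerAlgebra (hn : 0 < n) (a : K) : Module.finrank K (kummerAlgebra K n a) = n := by
  simpa using Module.finrank_eq_card_basis (kummerBasis K n hn a)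

theorem kummerRoot_pow (a : K) :
    (AdjoinRoot.root (X ^ n - C a : K[X])) ^ n = algebraMap K (kummerAlgebra K n a) a := by
  have h := AdjoinRoot.eval₂_root (X ^ n - C a : K[X])
  simp only [eval₂_sub, eval₂_pow, eval₂_X, eval₂_C, sub_eq_zero] at h
  exact h

theorem trace_kummerRoot_pow (hn : 0 < n) (a : K) {k : ℕ} (hk : k < n) :
    Algebra.trace K (kummerAlgebra K n a) (AdjoinRoot.root (X ^ n - C a) ^ k) =
      if k = 0 then (n : K) else 0 := by
  rw [Algebra.trace_eq_matrix_trace (kummerBasis K n hn a), Matrix.trace]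
  split_ifs with h
  · subst h
    simp
  · refine Finset.sum_eq_zero fun i _ => ?_
    rw [Matrix.diag_apply, Algebra.leftMulMatrix_eq_repr_mul, kummerBasis_apply, ← pow_add]
    by_cases hi : k + i < n
    · have : AdjoinRoot.root (X ^ n - C a) ^ (k + i) = kummerBasis K n hn a ⟨k + i, hi⟩ := by
        rw [kummerBasis_apply]
      rw [this, Module.Basis.repr_self, Finsupp.single_eq_of_ne]
      intro h'
      have := congrArg Fin.val h'
      simp at this
      omega
    · have hi2 : k + i - n < n := by omega
      have : AdjoinRoot.root (X ^ n - C a) ^ (k + i) =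
          a • kummerBasis K n hn a ⟨k + i - n, hi2⟩ := by
        rw [kummerBasis_apply, Algebra.smul_def, ← kummerRoot_pow, ← pow_add]
        congr 1
        simp only
        omega
      rw [this, map_smul, Module.Basis.repr_self, Finsupp.smul_apply, Finsupp.single_eq_of_ne,
        smul_zero]
      intro h'
      have := congrArg Fin.val h'
      simp at this
      omega

theorem discr_kummerBasis (hn : 0 < n) (a : K) :
    ∃ u : ℤˣ, Algebra.discr K (kummerBasis K n hn a) = ((u : ℤ) : K) * (n ^ n * a ^ (n - 1)) := by
  have : NeZero n := ⟨hn.ne'⟩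
  set M := Algebra.traceMatrix K (kummerBasis K n hn a) with hM
  -- The trace of `t ^ (i + j)` vanishes unless `n ∣ i + j`, so reindexing columns by `j ↦ -j`
  -- modulo `n` makes the trace matrix diagonal.
  have hsub : M.submatrix id (Equiv.neg (Fin n)) =
      Matrix.diagonal (fun i : Fin n => if i = 0 then (n : K) else n * a) := by
    ext i j
    have hval : ((-j : Fin n) : ℕ) = (n - j) % n := Fin.val_neg' j
    rw [Matrix.submatrix_apply, hM, Algebra.traceMatrix_apply, Algebra.traceForm_apply,
      kummerBasis_apply, kummerBasis_apply, ← pow_add, Matrix.diagonal_apply]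
    simp only [id_eq, Equiv.neg_apply, hval]
    by_cases hj : j = 0
    · subst hj
      simp only [Fin.val_zero, tsub_zero, Nat.mod_self, add_zero]
      rw [trace_kummerRoot_pow hn a i.2]
      by_cases hi : i = 0 <;> simp [hi]
    · have hj' : (j : ℕ) ≠ 0 := fun h => hj (Fin.ext h)
      rw [Nat.mod_eq_of_lt (by omega)]
      by_cases hlt : (i : ℕ) + (n - j) < n
      · rw [trace_kummerRoot_pow hn a hlt, if_neg (by omega), if_neg]
        rintro rfl
        omega
      · have : AdjoinRoot.root (X ^ n - C a) ^ ((i : ℕ) + (n - j)) =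
            a • AdjoinRoot.root (X ^ n - C a) ^ ((i : ℕ) - j) := by
          rw [Algebra.smul_def, ← kummerRoot_pow, ← pow_add]
          congr 1
          omega
        rw [this, map_smul, trace_kummerRoot_pow hn a (by omega)]
        by_cases hij : i = j
        · subst hij
          simp [hj, mul_comm]
        · have hij' : (i : ℕ) ≠ j := fun h => hij (Fin.ext h)
          rw [if_neg (by omega), if_neg hij, smul_zero]
  have hdet := congrArg Matrix.det hsub
  rw [Matrix.det_permute', Matrix.det_diagonal] at hdet
  refine ⟨Equiv.Perm.sign (Equiv.neg (Fin n)), ?_⟩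
  have hprod : ∏ i : Fin n, (if i = 0 then (n : K) else n * a) = n ^ n * a ^ (n - 1) := by
    have : ∀ i : Fin n, (if i = 0 then (n : K) else n * a) = n * (if i = 0 then 1 else a) := by
      intro i
      split_ifs <;> simp
    simp only [this, Finset.prod_mul_distrib, Finset.prod_const, Finset.card_univ,
      Fintype.card_fin]
    congr 1
    rw [Finset.prod_ite, Finset.prod_const_one, one_mul, Finset.prod_const,
      Finset.filter_ne' Finset.univ (0 : Fin n), Finset.card_erase_of_mem (Finset.mem_univ _),
      Finset.card_univ, Fintype.card_fin]
  rw [hprod] at hdet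
  rw [Algebra.discr_def, ← hM, ← hdet, ← mul_assoc, ← Int.cast_mul, ← Units.val_mul,
    Int.units_mul_self]
  simp

end

/-! ### Coefficients of integral elements -/

/-- The images of `x` under `t ↦ ζ ^ j * β` are integral; averaging them against powers of `ζ⁻¹`
isolates `n * c_k * β ^ k`. Its `n`-th power lies in `K`, since `β ^ n = a`. -/
theorem isIntegral_of_kummerBasis_repr_of_isAlgClosed {A K : Type*} [CommRing A] [Field K]
    [Algebra A K] {n : ℕ} (E : Type*) [Field E] [IsAlgClosed E]
    [CharZero E] [Algebra K E] [Algebra A E] [IsScalarTower A K E] (hn : 0 < n) (a : K)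
    {x : kummerAlgebra K n a} (hx : IsIntegral A x) (k : Fin n) :
    IsIntegral A ((n * (kummerBasis K n hn a).repr x k) ^ n * a ^ (k : ℕ)) := by
  have : NeZero n := ⟨hn.ne'⟩
  have : NeZero (n : E) := ⟨by exact_mod_cast hn.ne'⟩
  obtain ⟨ζ, hζ⟩ := HasEnoughRootsOfUnity.exists_primitiveRoot E n
  obtain ⟨β, hβ⟩ := IsAlgClosed.exists_pow_nat_eq (algebraMap K E a) hn
  have hroot : ∀ j : ℕ, aeval (ζ ^ j * β) (X ^ n - C a : K[X]) = 0 := by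
    intro j
    simp [mul_pow, hβ, ← pow_mul, mul_comm j n, pow_mul ζ n j, hζ.pow_eq_one]
  let φ : ℕ → kummerAlgebra K n a →ₐ[K] E := fun j =>
    AdjoinRoot.liftAlgHom _ (Algebra.ofId K E) (ζ ^ j * β) (hroot j)
  have hφroot : ∀ j, φ j (AdjoinRoot.root (X ^ n - C a)) = ζ ^ j * β := fun j =>
    AdjoinRoot.liftAlgHom_root ..
  have hφint : ∀ j, IsIntegral A (φ j x) := fun j => hx.map ((φ j).restrictScalars A)
  set c := (kummerBasis K n hn a).repr x with hc
  have hφx : ∀ j, φ j x = ∑ i : Fin n, algebraMap K E (c i) * (ζ ^ j * β) ^ (i : ℕ) := by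
    intro j
    conv_lhs => rw [← (kummerBasis K n hn a).sum_repr x]
    simp only [map_sum, kummerBasis_apply, Algebra.smul_def, map_mul, AlgHom.commutes, map_pow,
      hφroot, ← hc]
  have hζ0 : ζ ≠ 0 := hζ.ne_zero hn.ne'
  have hgeom : ∀ i : Fin n, ∑ j ∈ Finset.range n, (ζ ^ (i : ℕ) * ζ⁻¹ ^ (k : ℕ)) ^ j =
      if i = k then (n : E) else 0 := by
    intro i
    split_ifs with h
    · subst h
      simp [hζ0]
    · set q := ζ ^ (i : ℕ) * ζ⁻¹ ^ (k : ℕ) with hq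
      have hqn : q ^ n = 1 := by
        rw [hq, mul_pow, ← pow_mul, ← pow_mul, mul_comm (i : ℕ), mul_comm (k : ℕ), pow_mul,
          pow_mul, inv_pow, hζ.pow_eq_one]
        simp
      have hq1 : q - 1 ≠ 0 := by
        rw [sub_ne_zero]
        intro h1
        rw [hq, inv_pow, mul_inv_eq_one₀ (pow_ne_zero _ hζ0)] at h1
        exact h (Fin.ext (hζ.pow_inj i.2 k.2 h1))
      have := geom_sum_mul q n
      rw [hqn, sub_self] at this
      exact (mul_eq_zero.1 this).resolve_right hq1
  have hsum : ∑ j ∈ Finset.range n, (ζ⁻¹ ^ (k : ℕ)) ^ j * φ j x =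
      n * algebraMap K E (c k) * β ^ (k : ℕ) := by
    simp only [hφx, Finset.mul_sum]
    rw [Finset.sum_comm]
    have : ∀ i : Fin n, ∑ j ∈ Finset.range n, (ζ⁻¹ ^ (k : ℕ)) ^ j *
        (algebraMap K E (c i) * (ζ ^ j * β) ^ (i : ℕ)) =
        if i = k then n * algebraMap K E (c k) * β ^ (k : ℕ) else 0 := by
      intro i
      trans algebraMap K E (c i) * β ^ (i : ℕ) *
        ∑ j ∈ Finset.range n, (ζ ^ (i : ℕ) * ζ⁻¹ ^ (k : ℕ)) ^ j
      · rw [Finset.mul_sum]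
        refine Finset.sum_congr rfl fun j _ => ?_
        rw [mul_pow, mul_pow, ← pow_mul ζ, ← pow_mul ζ, mul_comm j (i : ℕ)]
        ring
      · rw [hgeom]
        split_ifs with h
        · subst h
          ring
        · simp
    rw [Finset.sum_congr rfl fun i _ => this i]
    simp
  have hζint : IsIntegral A ζ⁻¹ := by
    refine IsIntegral.of_pow hn ?_
    rw [inv_pow, hζ.pow_eq_one, inv_one]
    exact isIntegral_one
  have hint : IsIntegral A (n * algebraMap K E (c k) * β ^ (k : ℕ)) := by
    rw [← hsum]
    exact IsIntegral.sum _ fun j _ => ((hζint.pow _).pow _).mul (hφint j)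
  have hpow := hint.pow n
  rw [mul_pow _ (β ^ (k : ℕ)), ← pow_mul, mul_comm (k : ℕ) n, pow_mul, hβ] at hpow
  have : algebraMap K E ((n * c k) ^ n * a ^ (k : ℕ)) =
      (n * algebraMap K E (c k)) ^ n * algebraMap K E a ^ (k : ℕ) := by
    simp
  rw [← this] at hpow
  exact (isIntegral_algebraMap_iff (algebraMap K E).injective).1 hpow

theorem isIntegral_of_kummerBasis_repr {A K : Type*} [CommRing A] [Field K] [Algebra A K] {n : ℕ}
    [CharZero K] (hn : 0 < n) (a : K)
    {x : kummerAlgebra K n a} (hx : IsIntegral A x) (k : Fin n) :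
    IsIntegral A ((n * (kummerBasis K n hn a).repr x k) ^ n * a ^ (k : ℕ)) :=
  have : CharZero (AlgebraicClosure K) := charZero_of_injective_algebraMap
    (algebraMap K (AlgebraicClosure K)).injective
  isIntegral_of_kummerBasis_repr_of_isAlgClosed (AlgebraicClosure K) hn a hx k

theorem HeightOneSpectrum.valuation_le_one_of_isIntegral {A K : Type*} [CommRing A]
    [IsDedekindDomain A] [Field K] [Algebra A K] [IsFractionRing A K] (v : HeightOneSpectrum A) {x : K}
    (hx : IsIntegral A x) : v.valuation K x ≤ 1 := by
  obtain ⟨y, rfl⟩ := IsIntegrallyClosed.isIntegral_iff.1 hx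
  exact v.valuation_le_one y

theorem Valuation.map_det_le_one {R Γ ι : Type*} [CommRing R] [Fintype ι] [DecidableEq ι]
    [LinearOrderedCommGroupWithZero Γ] (w : Valuation R Γ) (M : Matrix ι ι R)
    (hM : ∀ i j, w (M i j) ≤ 1) : w M.det ≤ 1 := by
  have : M = (Matrix.of fun i j => (⟨M i j, hM i j⟩ : w.integer)).map w.integer.subtype := by
    ext i j
    rfl
  rw [this, ← RingHom.mapMatrix_apply, ← RingHom.map_det]
  exact (Matrix.det _ : w.integer).2

/-- Makes the rank a variable, so that bases can be indexed by `Fin n` without casts. -/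
theorem discrIdeal_eq_span_fin {A K L : Type*} [CommRing A] [Field K] [Algebra A K] [CommRing L]
    [Algebra K L] [Algebra A L] (m : ℕ)
    (h : Module.finrank K L = m) :
    discrIdeal A K L = Ideal.span {d : A | ∃ b : Module.Basis (Fin m) K L,
      (∀ i, IsIntegral A (b i)) ∧ algebraMap A K d = Algebra.discr K b} := by
  subst h
  rfl

/-! ### Local bounds on the discriminant ideal -/

section

variable {A K : Type*} [CommRing A] [IsDedekindDomain A] [Field K] [Algebra A K]
  [IsFractionRing A K] {n : ℕ}

theorem WithZero.exp_sum {ι : Type*} (s : Finset ι) (f : ι → ℤ) :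
    WithZero.exp (∑ i ∈ s, f i) = ∏ i ∈ s, WithZero.exp (f i) := by
  classical
  induction s using Finset.induction_on with
  | empty => simp
  | insert i s hi ih => rw [Finset.sum_insert hi, Finset.prod_insert hi, WithZero.exp_add, ih]

theorem HeightOneSpectrum.valuation_eq_exp_neg (v : HeightOneSpectrum A) {a : K} (ha : a ≠ 0) :
    v.valuation K a = WithZero.exp (-(-WithZero.log (v.valuation K a))) := by
  rw [neg_neg, WithZero.exp_log ((Valuation.ne_zero_iff _).2 ha)]

theorem HeightOneSpectrum.valuation_discr_kummerBasis (hn : 0 < n) {a : K} (ha : a ≠ 0)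
    (v : HeightOneSpectrum A) :
    v.valuation K (Algebra.discr K (kummerBasis K n hn a)) =
      WithZero.exp (-(((n : ℤ) - 1) * -WithZero.log (v.valuation K a))) *
        v.valuation K (n : K) ^ n := by
  obtain ⟨u, hu⟩ := discr_kummerBasis hn a
  have h1 : v.valuation K ((u : ℤ) : K) = 1 := by
    rcases Int.units_eq_one_or u with rfl | rfl <;> simp
  rw [hu, map_mul, h1, one_mul, map_mul, map_pow, map_pow, mul_comm]
  congr 1
  conv_lhs => rw [HeightOneSpectrum.valuation_eq_exp_neg v ha]
  rw [← WithZero.exp_nsmul, nsmul_eq_mul, Nat.cast_sub hn]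
  congr 1
  push_cast
  ring

theorem discrIdeal_kummerAlgebra_le_pow [CharZero K] (hn : 0 < n) {a : K} (ha : a ≠ 0)
    (v : HeightOneSpectrum A) (hv : (n : A) ∉ v.asIdeal) :
    discrIdeal A K (kummerAlgebra K n a) ≤
      v.asIdeal ^ (n - Int.gcd (-WithZero.log (v.valuation K a)) n) := by
  rw [discrIdeal_eq_span_fin n (finrank_kummerAlgebra hn a), Ideal.span_le]
  rintro d ⟨b, hb, hd⟩
  rw [SetLike.mem_coe, ← v.intValuation_le_pow_iff_mem,
    ← v.valuation_of_algebraMap (K := K)]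
  change v.valuation K (algebraMap A K d) ≤ _
  rw [hd]
  set w := v.valuation K with hw
  set m : ℤ := -WithZero.log (w a) with hm
  have hwa : w a = WithZero.exp (-m) := HeightOneSpectrum.valuation_eq_exp_neg v ha
  have hwn : w (n : K) = 1 := by
    have := (v.valuation_eq_one_iff_notMem (K := K)).2 hv
    simpa using this
  set pb := kummerBasis K n hn a with hpb
  set f : Fin n → ℤ := fun i => ((i : ℕ) * m) / (n : ℤ) with hf
  let T : Matrix (Fin n) (Fin n) K := Matrix.of fun j i => pb.repr (b j) i
  have hbT : (b : Fin n → kummerAlgebra K n a) =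
      (T.map (algebraMap K (kummerAlgebra K n a))).mulVec pb := by
    ext j
    conv_lhs => rw [← pb.sum_repr (b j)]
    simp only [Matrix.mulVec, dotProduct, Matrix.map_apply, T, Matrix.of_apply, Algebra.smul_def]
  have hT : ∀ j i, w (T j i) ≤ WithZero.exp (f i) := by
    intro j i
    have h := HeightOneSpectrum.valuation_le_one_of_isIntegral v
      (isIntegral_of_kummerBasis_repr hn a (hb j) i)
    change w ((n * T j i) ^ n * a ^ (i : ℕ)) ≤ 1 at h
    rw [map_mul, map_pow, map_mul, map_pow, hwn, one_mul, hwa] at h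
    by_cases h0 : w (T j i) = 0
    · rw [h0]
      exact zero_le
    · rw [← WithZero.exp_log h0, ← WithZero.exp_nsmul, ← WithZero.exp_nsmul, ← WithZero.exp_add,
        ← WithZero.exp_zero, WithZero.exp_le_exp] at h
      simp only [nsmul_eq_mul] at h
      rw [← WithZero.exp_log h0, WithZero.exp_le_exp, hf,
        Int.le_ediv_iff_mul_le (by exact_mod_cast hn)]
      linarith
  obtain ⟨π, hπ⟩ := v.valuation_exists_uniformizer K
  have hdet : w T.det ≤ WithZero.exp (∑ i, f i) := by
    -- Scaling column `i` by `π ^ f i` makes all entries integral at `v`, so the scaled determinant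
    -- is too.
    have h := Valuation.map_det_le_one w (T * Matrix.diagonal fun i => π ^ f i) (by
      intro j i
      rw [Matrix.mul_diagonal, map_mul, map_zpow₀, hw, hπ, ← WithZero.exp_zsmul, ← hw]
      calc _ ≤ WithZero.exp (f i) * WithZero.exp (f i • (-1)) := mul_le_mul_left (hT j i) _
        _ = 1 := by rw [← WithZero.exp_add]; simp)
    rw [Matrix.det_mul, Matrix.det_diagonal, map_mul, map_prod] at h
    have h2 : ∏ i, w (π ^ f i) = WithZero.exp (-∑ i, f i) := by
      simp only [map_zpow₀, hw, hπ, ← WithZero.exp_zsmul]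
      rw [← WithZero.exp_sum]
      simp
    rw [h2, WithZero.exp_neg, ← div_eq_mul_inv] at h
    exact (div_le_one₀ WithZero.exp_pos).1 h
  rw [hbT, Algebra.discr_of_matrix_mulVec, map_mul, map_pow,
    HeightOneSpectrum.valuation_discr_kummerBasis hn ha v, ← hw, hwn, one_pow, mul_one, ← hm]
  have hgcd : Int.gcd m n ≤ n := Nat.gcd_le_right _ hn
  calc _ ≤ WithZero.exp (∑ i, f i) ^ 2 * WithZero.exp (-(((n : ℤ) - 1) * m)) :=
        mul_le_mul_left (pow_le_pow_left' hdet 2) _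
    _ = WithZero.exp (-((n - Int.gcd m n : ℕ) : ℤ)) := by
      rw [← WithZero.exp_nsmul, ← WithZero.exp_add, nsmul_eq_mul, Nat.cast_ofNat, hf,
        two_mul_sum_mul_ediv n hn m, Nat.cast_sub hgcd]
      congr 1
      ring

/-- A power of a uniformizer has the right valuation at `v` but may spoil integrality elsewhere; a
factor `s` prime to `v` clears those denominators. -/
theorem exists_kummer_scaling (hn : 0 < n) {a : K} (ha : a ≠ 0) (v : HeightOneSpectrum A)
    (i : ℕ) : ∃ c : K, c ≠ 0 ∧ IsIntegral A (c ^ n * a ^ i) ∧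
      v.valuation K c = WithZero.exp (i * -WithZero.log (v.valuation K a) / (n : ℤ)) := by
  set m : ℤ := -WithZero.log (v.valuation K a) with hm
  have hwa : v.valuation K a = WithZero.exp (-m) := HeightOneSpectrum.valuation_eq_exp_neg v ha
  set f : ℤ := i * m / n with hf
  obtain ⟨π, hπ⟩ := v.valuation_exists_uniformizer K
  have hπ0 : π ≠ 0 := by
    rintro rfl
    exact WithZero.exp_ne_zero ((map_zero _).symm.trans hπ).symm
  have hy : v.valuation K ((π ^ (-f)) ^ n * a ^ i) ≤ 1 := by
    rw [map_mul, map_pow, map_pow, map_zpow₀, hπ, hwa, ← WithZero.exp_zsmul,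
      ← WithZero.exp_nsmul, ← WithZero.exp_nsmul, ← WithZero.exp_add, ← WithZero.exp_zero,
      WithZero.exp_le_exp]
    have := Int.ediv_mul_le (i * m) (by exact_mod_cast hn.ne' : (n : ℤ) ≠ 0)
    simp only [smul_eq_mul, nsmul_eq_mul]
    linarith
  obtain ⟨r, s, hrs⟩ := v.exists_primeCompl_mul_eq_of_integer _ hy
  have hs : v.valuation K (algebraMap A K s) = 1 :=
    v.valuation_eq_one_iff_notMem.2 s.2
  have hs0 : algebraMap A K s ≠ 0 := by
    intro h
    simp [h] at hs
  refine ⟨π ^ (-f) * algebraMap A K s, mul_ne_zero (zpow_ne_zero _ hπ0) hs0, ?_, ?_⟩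
  · have : (π ^ (-f) * algebraMap A K s) ^ n * a ^ i =
        algebraMap A K (r * s ^ (n - 1)) := by
      rw [map_mul, ← hrs, map_pow, mul_assoc _ (algebraMap A K s), mul_pow, mul_pow_sub_one hn.ne']
      ring
    rw [this]
    exact isIntegral_algebraMap
  · rw [map_mul, hs, mul_one, map_zpow₀, hπ, ← WithZero.exp_zsmul]
    simp

/-- The basis is `c_i t ^ i`, integral because `(c_i t ^ i) ^ n = c_i ^ n * a ^ i`. -/
theorem exists_mem_discrIdeal_kummerAlgebra (hn : 0 < n) {a : K} (ha : a ≠ 0)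
    (v : HeightOneSpectrum A) :
    ∃ d ∈ discrIdeal A K (kummerAlgebra K n a), v.valuation K (algebraMap A K d) =
      WithZero.exp (-((n - Int.gcd (-WithZero.log (v.valuation K a)) n : ℕ) : ℤ)) *
        v.valuation K (n : K) ^ n := by
  choose c hc0 hcint hcv using fun i : Fin n => exists_kummer_scaling hn ha v i
  set m : ℤ := -WithZero.log (v.valuation K a) with hm
  set pb := kummerBasis K n hn a with hpb
  let b := pb.unitsSMul fun i => Units.mk0 (c i) (hc0 i)
  have hb : ∀ i, b i = c i • pb i := fun i => pb.unitsSMul_apply i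
  have hbint : ∀ i, IsIntegral A (b i) := by
    intro i
    refine IsIntegral.of_pow hn ?_
    have : b i ^ n = algebraMap K (kummerAlgebra K n a) (c i ^ n * a ^ (i : ℕ)) := by
      rw [hb, hpb, kummerBasis_apply, Algebra.smul_def, mul_pow, ← pow_mul, mul_comm (i : ℕ) n,
        pow_mul, kummerRoot_pow, map_mul, map_pow, map_pow]
    rw [this]
    exact (hcint i).algebraMap
  have hbdiag : (b : Fin n → kummerAlgebra K n a) =
      ((Matrix.diagonal c).map (algebraMap K (kummerAlgebra K n a))).mulVec pb := by
    ext i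
    rw [hb, Matrix.diagonal_map (map_zero _), Matrix.mulVec_diagonal, Algebra.smul_def]
  have hdiscr : Algebra.discr K b = (∏ i, c i) ^ 2 * Algebra.discr K pb := by
    rw [hbdiag, Algebra.discr_of_matrix_mulVec, Matrix.det_diagonal]
  have hint : IsIntegral A (Algebra.discr K b) := by
    obtain ⟨u, hu⟩ := discr_kummerBasis hn a
    rw [hdiscr, hu]
    have h1 : IsIntegral A ((∏ i, c i) ^ 2 * a ^ (n - 1)) := by
      refine IsIntegral.of_pow hn ?_
      -- The exponents of `a` match because `2 ∑ i = n (n - 1)`.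
      have : ((∏ i, c i) ^ 2 * a ^ (n - 1)) ^ n = (∏ i, (c i ^ n * a ^ (i : ℕ))) ^ 2 := by
        rw [Finset.prod_mul_distrib, Finset.prod_pow, Finset.prod_pow_eq_pow_sum, mul_pow,
          mul_pow, ← pow_mul, ← pow_mul, ← pow_mul, ← pow_mul, mul_comm 2 n,
          Fin.sum_univ_eq_sum_range (fun i => i) n, Finset.sum_range_id_mul_two, mul_comm n (n - 1)]
      rw [this]
      exact (IsIntegral.prod _ fun i _ => hcint i).pow 2
    have h2 : (∏ i, c i) ^ 2 * (((u : ℤ) : K) * ((n : K) ^ n * a ^ (n - 1))) =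
        algebraMap A K ((u : ℤ) * n ^ n) * ((∏ i, c i) ^ 2 * a ^ (n - 1)) := by
      rw [map_mul, map_pow, map_natCast, map_intCast]
      ring
    rw [h2]
    exact isIntegral_algebraMap.mul h1
  obtain ⟨d, hd⟩ := IsIntegrallyClosed.isIntegral_iff.1 hint
  refine ⟨d, ?_, ?_⟩
  · rw [discrIdeal_eq_span_fin n (finrank_kummerAlgebra hn a)]
    exact Ideal.subset_span ⟨b, hbint, hd⟩
  · have hgcd : Int.gcd m n ≤ n := Nat.gcd_le_right _ hn
    rw [hd, hdiscr, map_mul, HeightOneSpectrum.valuation_discr_kummerBasis hn ha v, ← hm,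
      ← mul_assoc, map_pow, map_prod]
    congr 1
    simp only [hcv]
    rw [← WithZero.exp_sum, ← WithZero.exp_nsmul, ← WithZero.exp_add, nsmul_eq_mul,
      Nat.cast_ofNat, two_mul_sum_mul_ediv n hn m, Nat.cast_sub hgcd]
    congr 1
    ring

end

/-! ### Exponents in the prime factorization -/

theorem Ideal.le_pow_iff_le_count {A : Type*} [CommRing A] [IsDedekindDomain A] {I : Ideal A}
    (hI : I ≠ 0) (v : HeightOneSpectrum A) (k : ℕ) :
    I ≤ v.asIdeal ^ k ↔ k ≤ (Associates.mk v.asIdeal).count (Associates.mk I).factors := by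
  rw [← Ideal.dvd_iff_le, ← Associates.mk_le_mk_iff_dvd, Associates.mk_pow,
    Associates.prime_pow_dvd_iff_le (Associates.mk_ne_zero.2 hI) v.associates_irreducible]

section

variable {A K : Type*} [CommRing A] [IsDedekindDomain A] [Field K] [Algebra A K]
  [IsFractionRing A K] {n : ℕ}

theorem discrIdeal_kummerAlgebra_ne_zero [CharZero K] (hn : 0 < n) {a : K} (ha : a ≠ 0)
    (v : HeightOneSpectrum A) : discrIdeal A K (kummerAlgebra K n a) ≠ 0 := by
  obtain ⟨d, hd, hv⟩ := exists_mem_discrIdeal_kummerAlgebra hn ha v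
  intro h
  rw [h, Ideal.zero_eq_bot, Ideal.mem_bot] at hd
  rw [hd, map_zero, map_zero] at hv
  refine mul_ne_zero WithZero.exp_ne_zero (pow_ne_zero _ ?_) hv.symm
  rw [Valuation.ne_zero_iff]
  exact_mod_cast hn.ne'

theorem count_discrIdeal_kummerAlgebra_le [CharZero K] (hn : 0 < n) {a : K} (ha : a ≠ 0)
    (v : HeightOneSpectrum A) :
    (((Associates.mk v.asIdeal).count
      (Associates.mk (discrIdeal A K (kummerAlgebra K n a))).factors : ℕ) : ℤ) ≤
      (n - Int.gcd (-WithZero.log (v.valuation K a)) n : ℕ) +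
        n * -WithZero.log (v.valuation K (n : K)) := by
  set D := discrIdeal A K (kummerAlgebra K n a) with hD
  set k := (Associates.mk v.asIdeal).count (Associates.mk D).factors with hk
  have hle := (Ideal.le_pow_iff_le_count (discrIdeal_kummerAlgebra_ne_zero hn ha v) v k).2 hk.le
  obtain ⟨d, hd, hv⟩ := exists_mem_discrIdeal_kummerAlgebra hn ha v
  have h := (v.intValuation_le_pow_iff_mem d k).2 (hle hd)
  rw [← v.valuation_of_algebraMap (K := K)] at h
  change v.valuation K (algebraMap A K d) ≤ _ at h
  have hn0 : (n : K) ≠ 0 := by exact_mod_cast hn.ne'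
  rw [hv, HeightOneSpectrum.valuation_eq_exp_neg v hn0, ← WithZero.exp_nsmul, ← WithZero.exp_add,
    WithZero.exp_le_exp, nsmul_eq_mul] at h
  linarith

theorem count_discrIdeal_kummerAlgebra [CharZero K] (hn : 0 < n) {a : K} (ha : a ≠ 0)
    (v : HeightOneSpectrum A) (hv : (n : A) ∉ v.asIdeal) :
    (Associates.mk v.asIdeal).count
      (Associates.mk (discrIdeal A K (kummerAlgebra K n a))).factors =
      n - Int.gcd (-WithZero.log (v.valuation K a)) n := by
  refine le_antisymm ?_ ((Ideal.le_pow_iff_le_count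
    (discrIdeal_kummerAlgebra_ne_zero hn ha v) v _).1 (discrIdeal_kummerAlgebra_le_pow hn ha v hv))
  have h := count_discrIdeal_kummerAlgebra_le hn ha v
  have hwn : v.valuation K (n : K) = 1 := by
    simpa using (v.valuation_eq_one_iff_notMem (K := K)).2 hv
  rw [hwn, WithZero.log_one, neg_zero, mul_zero, add_zero] at h
  exact_mod_cast h

theorem exists_discrIdeal_kummerAlgebra_eq (A K : Type*) [CommRing A] [IsDedekindDomain A]
    [Field K] [Algebra A K] [IsFractionRing A K] [CharZero K] (hA : ¬ IsField A) (hn : 0 < n) :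
    ∃ C : ℕ, 0 < C ∧ ∃ e : Kˣ → HeightOneSpectrum A → ℕ,
      (∀ (a : Kˣ) (v : HeightOneSpectrum A), (n : A) ∈ v.asIdeal → e a v ≤ C) ∧
      ∀ a : Kˣ,
        discrIdeal A K (kummerAlgebra K n (a : K)) =
          (∏ᶠ (v : HeightOneSpectrum A)
              (_ : (n : A) ∉ v.asIdeal ∧ -WithZero.log (v.valuation K (a : K)) ≠ 0),
              v.asIdeal ^ (n - Int.gcd (-WithZero.log (v.valuation K (a : K))) n)) *
            ∏ᶠ (v : HeightOneSpectrum A) (_ : (n : A) ∈ v.asIdeal), v.asIdeal ^ e a v := by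
  classical
  have hn0 : (n : A) ≠ 0 := by
    intro h
    have := congrArg (algebraMap A K) h
    rw [map_natCast, map_zero] at this
    exact hn.ne' (by exact_mod_cast this)
  have hfin : {v : HeightOneSpectrum A | (n : A) ∈ v.asIdeal}.Finite := by
    have := Ideal.finite_factors (R := A) (I := Ideal.span {(n : A)})
      (by simpa using hn0)
    simpa [Ideal.dvd_span_singleton] using this
  let t : HeightOneSpectrum A → ℕ := fun v => (-WithZero.log (v.valuation K (n : K))).toNat
  obtain ⟨B, hB⟩ := (hfin.image t).bddAbove
  -- The exponent is the true multiplicity of `v` in the discriminant ideal; only its bound needs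
  -- proof, with `B` bounding `v(n)` over the finitely many `v ∣ n`.
  let e : Kˣ → HeightOneSpectrum A → ℕ := fun a v => (Associates.mk v.asIdeal).count
    (Associates.mk (discrIdeal A K (kummerAlgebra K n (a : K)))).factors
  refine ⟨n + n * B, by positivity, e, fun a v hv => ?_, fun a => ?_⟩
  · have h1 := count_discrIdeal_kummerAlgebra_le hn a.ne_zero v
    have h2 : t v ≤ B := hB ⟨v, hv, rfl⟩
    have h3 : -WithZero.log (v.valuation K (n : K)) ≤ B :=
      (Int.self_le_toNat _).trans (by exact_mod_cast h2)
    have h4 : (n : ℤ) * -WithZero.log (v.valuation K (n : K)) ≤ n * B :=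
      mul_le_mul_of_nonneg_left h3 (by positivity)
    have h5 : n - Int.gcd (-WithZero.log (v.valuation K (a : K))) n ≤ n := Nat.sub_le _ _
    have : ((e a v : ℕ) : ℤ) ≤ ((n + n * B : ℕ) : ℤ) := by
      push_cast
      refine h1.trans (add_le_add (by exact_mod_cast h5) h4)
    exact_mod_cast this
  · set D := discrIdeal A K (kummerAlgebra K n (a : K)) with hD
    -- One place suffices to show `D ≠ 0`; it exists because `A` is not a field.
    have : Nonempty (HeightOneSpectrum A) := by
      obtain ⟨M, hM⟩ := Ideal.exists_maximal A
      exact ⟨⟨M, hM.isPrime, Ring.ne_bot_of_isMaximal_of_not_isField hM hA⟩⟩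
    obtain ⟨v₀⟩ := this
    have hD0 : D ≠ 0 := discrIdeal_kummerAlgebra_ne_zero hn a.ne_zero v₀
    have hsupp : (Function.mulSupport fun v : HeightOneSpectrum A => v.maxPowDividing D).Finite :=
      Ideal.hasFiniteMulSupport hD0
    have hsplit := finprod_mem_mul_sdiff' (s := {v : HeightOneSpectrum A | (n : A) ∉ v.asIdeal})
      (t := Set.univ) (Set.subset_univ _) (hsupp.inter_of_right _)
    rw [finprod_mem_univ, Ideal.finprod_heightOneSpectrum_factorization hD0] at hsplit
    rw [← hsplit]
    congr 1
    · refine finprod_congr fun v => ?_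
      simp only [Set.mem_ofPred_eq]
      by_cases hv : (n : A) ∉ v.asIdeal
      · have hc := count_discrIdeal_kummerAlgebra hn a.ne_zero v hv
        rw [finprod_eq_if, if_pos hv, HeightOneSpectrum.maxPowDividing, hD, hc, finprod_eq_if]
        split_ifs with h
        · rfl
        · have h0 : -WithZero.log (v.valuation K (a : K)) = 0 := by
            by_contra h'
            exact h ⟨hv, h'⟩
          rw [h0]
          simp
      · simp [hv]
    · refine finprod_congr fun v => ?_
      simp only [Set.mem_sdiff, Set.mem_univ, Set.mem_ofPred_eq, true_and, not_not]
      rfl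

end

/-! ### The rational case -/

theorem irreducible_X_pow_sub_C_of_squarefree {n : ℕ} (hn : 0 < n) {a : ℤ} (ha : Squarefree a)
    (ha1 : a ≠ 1) (ha1' : a ≠ -1) : Irreducible (X ^ n - C (a : ℚ) : ℚ[X]) := by
  have hna : a.natAbs ≠ 1 := by omega
  obtain ⟨p, hp, hpa⟩ := Nat.exists_prime_and_dvd hna
  have hpZ : Prime (p : ℤ) := Nat.prime_iff_prime_int.1 hp
  have hpa' : (p : ℤ) ∣ a := Int.natCast_dvd.2 hpa
  have hmonic : (X ^ n - C a : ℤ[X]).Monic := monic_X_pow_sub_C a hn.ne'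
  have hdeg : (X ^ n - C a : ℤ[X]).natDegree = n := natDegree_X_pow_sub_C
  -- Any prime divisor `p` of the squarefree `a` divides it exactly once.
  have hE : (X ^ n - C a : ℤ[X]).IsEisensteinAt (Ideal.span {(p : ℤ)}) := by
    refine ⟨?_, ?_, ?_⟩
    · rw [hmonic.leadingCoeff, Ideal.mem_span_singleton]
      exact fun h => hpZ.not_isUnit (isUnit_of_dvd_one h)
    · intro k hk
      rw [hdeg] at hk
      rw [Ideal.mem_span_singleton, coeff_sub, coeff_X_pow, if_neg hk.ne, coeff_C, zero_sub]
      split_ifs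
      · exact hpa'.neg_right
      · simp
    · rw [coeff_sub, coeff_X_pow, if_neg hn.ne, coeff_C_zero, zero_sub, Ideal.span_singleton_pow,
        Ideal.mem_span_singleton, dvd_neg, sq]
      exact fun h => hpZ.not_isUnit (ha _ h)
  have hirr : Irreducible (X ^ n - C a : ℤ[X]) :=
    hE.irreducible ((Ideal.span_singleton_prime hpZ.ne_zero).2 hpZ) hmonic.isPrimitive
      (by rw [hdeg]; exact hn)
  have := (hmonic.irreducible_iff_irreducible_map_fraction_map (K := ℚ)).1 hirr
  simpa using this

theorem HeightOneSpectrum.exists_prime_span (v : HeightOneSpectrum ℤ) :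
    ∃ p : ℕ, p.Prime ∧ v.asIdeal = Ideal.span {(p : ℤ)} := by
  obtain ⟨g, hg⟩ := IsPrincipalIdealRing.principal v.asIdeal
  have hg' : v.asIdeal = Ideal.span {(g.natAbs : ℤ)} := by
    rw [Int.span_natAbs]
    exact hg
  refine ⟨g.natAbs, ?_, hg'⟩
  have h0 : (g.natAbs : ℤ) ≠ 0 := by
    intro h
    rw [h] at hg'
    exact v.ne_bot (by simpa using hg')
  have := v.isPrime
  rw [hg', Ideal.span_singleton_prime h0] at this
  exact Nat.prime_iff_prime_int.2 this

/-- The place of `ℤ` given by a prime number. -/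
def primePlace (p : Nat.Primes) : HeightOneSpectrum ℤ where
  asIdeal := Ideal.span {((p : ℕ) : ℤ)}
  isPrime := (Ideal.span_singleton_prime (by exact_mod_cast p.2.ne_zero)).2
    (Nat.prime_iff_prime_int.1 p.2)
  ne_bot := by simpa using p.2.ne_zero

theorem primePlace_bijective : Function.Bijective primePlace := by
  refine ⟨fun p q h => ?_, fun v => ?_⟩
  · have h' : Ideal.span {((p : ℕ) : ℤ)} = Ideal.span {((q : ℕ) : ℤ)} :=
      congrArg HeightOneSpectrum.asIdeal h
    rw [Ideal.span_singleton_eq_span_singleton, Int.associated_iff_natAbs] at h'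
    exact Subtype.ext (by simpa using h')
  · obtain ⟨p, hp, hv⟩ := HeightOneSpectrum.exists_prime_span v
    exact ⟨⟨p, hp⟩, HeightOneSpectrum.ext hv.symm⟩

theorem finprod_heightOneSpectrum_int_eq_prod {M : Type*} [CommMonoid M]
    {P : HeightOneSpectrum ℤ → Prop} {s : Finset ℕ} (hs : ∀ p ∈ s, p.Prime)
    (hP : ∀ p : Nat.Primes, P (primePlace p) ↔ (p : ℕ) ∈ s) {F : HeightOneSpectrum ℤ → M}
    {G : ℕ → M} (hFG : ∀ p : Nat.Primes, (p : ℕ) ∈ s → F (primePlace p) = G p) :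
    ∏ᶠ (v : HeightOneSpectrum ℤ) (_ : P v), F v = ∏ p ∈ s, G p := by
  rw [← finprod_mem_coe_finset]
  symm
  trans ∏ᶠ p ∈ {p : Nat.Primes | (p : ℕ) ∈ s}, G p
  · symm
    refine finprod_mem_eq_of_bijOn (fun p : Nat.Primes => (p : ℕ)) ⟨fun p hp => hp,
      fun p _ q _ h => Subtype.ext h, fun p hp => ⟨⟨p, hs p hp⟩, hp, rfl⟩⟩ fun _ _ => rfl
  · refine finprod_mem_eq_of_bijOn (t := {v | P v}) primePlace ⟨fun p hp => (hP p).2 hp,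
      primePlace_bijective.1.injOn, fun v hv => ?_⟩ fun p hp => (hFG p hp).symm
    obtain ⟨p, rfl⟩ := primePlace_bijective.2 v
    exact ⟨p, (hP p).1 hv, rfl⟩

theorem natCast_mem_primePlace (p : Nat.Primes) (n : ℕ) :
    (n : ℤ) ∈ (primePlace p).asIdeal ↔ (p : ℕ) ∣ n := by
  rw [primePlace, Ideal.mem_span_singleton, Int.natCast_dvd_natCast]

theorem neg_log_valuation_primePlace (p : Nat.Primes) {a : ℤ} (ha : a ≠ 0) :
    -WithZero.log ((primePlace p).valuation ℚ (a : ℚ)) = padicValInt p a := by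
  have : Fact (p : ℕ).Prime := ⟨p.2⟩
  -- Both valuations are determined by which powers of `p` divide `a`.
  have hmem : ∀ k : ℕ, (primePlace p).valuation ℚ (a : ℚ) ≤ WithZero.exp (-(k : ℤ)) ↔
      k ≤ padicValInt p a := by
    intro k
    have h : (primePlace p).valuation ℚ (a : ℚ) = (primePlace p).intValuation a :=
      (primePlace p).valuation_of_algebraMap a
    rw [h, (primePlace p).intValuation_le_pow_iff_mem, primePlace, Ideal.span_singleton_pow,
      Ideal.mem_span_singleton, padicValInt_dvd_iff]
    simp [ha]
  have h0 : (primePlace p).valuation ℚ (a : ℚ) ≠ 0 := by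
    rw [Valuation.ne_zero_iff]
    exact_mod_cast ha
  have h1 := (hmem (padicValInt p a)).2 le_rfl
  have h2 := (hmem (padicValInt p a + 1)).not.2 (by omega)
  rw [← WithZero.exp_log h0, WithZero.exp_le_exp] at h1 h2
  push_cast at h2
  omega

theorem prod_primeFactors_span_of_squarefree {a : ℤ} (ha : Squarefree a) {n : ℕ} :
    ∏ p ∈ a.natAbs.primeFactors, Ideal.span {(p : ℤ)} ^ (n - Nat.gcd (padicValInt p a) n) =
      Ideal.span {a} ^ (n - 1) := by
  have hsq : Squarefree a.natAbs := Int.squarefree_natAbs.2 ha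
  have hval : ∀ p ∈ a.natAbs.primeFactors, padicValInt p a = 1 := by
    intro p hp
    rw [padicValInt, ← Nat.factorization_def _ (Nat.prime_of_mem_primeFactors hp)]
    exact Nat.factorization_eq_one_of_squarefree hsq (Nat.prime_of_mem_primeFactors hp)
      (Nat.dvd_of_mem_primeFactors hp)
  rw [Finset.prod_congr rfl fun p hp => by rw [hval p hp, Nat.gcd_one_left], Finset.prod_pow,
    Ideal.prod_span_singleton, ← Nat.cast_prod, Nat.prod_primeFactors_of_squarefree hsq,
    Int.span_natAbs]

theorem exists_discrIdeal_kummerAlgebra_int_eq {n : ℕ} (hn : 0 < n) :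
    ∃ C : ℕ, 0 < C ∧ ∃ e : ℤ → ℕ → ℕ,
      (∀ (a : ℤ) (p : ℕ), p ∈ n.primeFactors → e a p ≤ C) ∧
      ∀ a : ℤ, a ≠ 0 → IsCoprime a (n : ℤ) →
        discrIdeal ℤ ℚ (kummerAlgebra ℚ n (a : ℚ)) =
          (∏ p ∈ a.natAbs.primeFactors,
              Ideal.span {(p : ℤ)} ^ (n - Nat.gcd (padicValInt p a) n)) *
            ∏ p ∈ n.primeFactors, Ideal.span {(p : ℤ)} ^ e a p := by
  obtain ⟨C, hC, e, he, hD⟩ := exists_discrIdeal_kummerAlgebra_eq ℤ ℚ Int.not_isField hn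
  classical
  -- The value `0` is junk, for `p` not prime or `a = 0`.
  refine ⟨C, hC, fun a p => if h : p.Prime ∧ (a : ℚ) ≠ 0 then
    e (Units.mk0 (a : ℚ) h.2) (primePlace ⟨p, h.1⟩) else 0, fun a p hp => ?_,
    fun a ha hcop => ?_⟩
  · dsimp only
    split_ifs with h
    · exact he _ _ ((natCast_mem_primePlace _ _).2 (Nat.dvd_of_mem_primeFactors hp))
    · exact Nat.zero_le _
  · have haQ : (a : ℚ) ≠ 0 := by exact_mod_cast ha
    have h := hD (Units.mk0 (a : ℚ) haQ)
    rw [Units.val_mk0] at h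
    have hcop' : Nat.Coprime a.natAbs n :=
      Int.isCoprime_iff_gcd_eq_one.1 hcop
    rw [finprod_heightOneSpectrum_int_eq_prod (s := a.natAbs.primeFactors)
        (fun p hp => Nat.prime_of_mem_primeFactors hp) ?_ (G := fun p =>
          Ideal.span {(p : ℤ)} ^ (n - Nat.gcd (padicValInt p a) n)) ?_,
      finprod_heightOneSpectrum_int_eq_prod (s := n.primeFactors)
        (fun p hp => Nat.prime_of_mem_primeFactors hp) ?_ (G := fun p =>
          Ideal.span {(p : ℤ)} ^ (if h : p.Prime ∧ (a : ℚ) ≠ 0 then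
            e (Units.mk0 (a : ℚ) h.2) (primePlace ⟨p, h.1⟩) else 0)) ?_] at h
    · convert h using 1
    · intro p
      rw [natCast_mem_primePlace, Nat.mem_primeFactors]
      simp [p.2, hn.ne']
    · intro p _
      simp only [dif_pos (And.intro p.2 haQ)]
      rfl
    · intro p
      have : Fact (p : ℕ).Prime := ⟨p.2⟩
      rw [natCast_mem_primePlace, neg_log_valuation_primePlace p ha, Nat.mem_primeFactors]
      have hdvd : (padicValInt p a : ℤ) ≠ 0 ↔ (p : ℕ) ∣ a.natAbs := by
        rw [Nat.cast_ne_zero, padicValInt, ← dvd_iff_padicValNat_ne_zero (by omega)]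
      rw [hdvd]
      refine ⟨fun h => ⟨p.2, h.2, by omega⟩, fun h => ⟨fun h' => ?_, h.2.1⟩⟩
      -- Coprimality makes the condition `p ∤ n` automatic for `p ∣ a`.
      exact Nat.not_coprime_of_dvd_of_dvd p.2.one_lt h.2.1 h' hcop'
    · intro p _
      rw [neg_log_valuation_primePlace p ha]
      rfl

theorem mainTheorem4 (n : ℕ) (hn : 0 < n) :
    (∀ (K : Type*) [Field K] [NumberField K],
      ∃ C : ℕ, 0 < C ∧ ∃ e : Kˣ → HeightOneSpectrum (𝓞 K) → ℕ,
        (∀ (a : Kˣ) (v : HeightOneSpectrum (𝓞 K)), (n : 𝓞 K) ∈ v.asIdeal → e a v ≤ C) ∧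
        ∀ a : Kˣ,
          discrIdeal (𝓞 K) K (kummerAlgebra K n (a : K)) =
            (∏ᶠ (v : HeightOneSpectrum (𝓞 K)) (_ : (n : 𝓞 K) ∉ v.asIdeal ∧ placeOrd v a ≠ 0),
                v.asIdeal ^ (n - Int.gcd (placeOrd v a) n)) *
              ∏ᶠ (v : HeightOneSpectrum (𝓞 K)) (_ : (n : 𝓞 K) ∈ v.asIdeal),
                v.asIdeal ^ e a v) ∧
    (∃ C : ℕ, 0 < C ∧ ∃ e : ℤ → ℕ → ℕ,
      (∀ (a : ℤ) (p : ℕ), p ∈ n.primeFactors → e a p ≤ C) ∧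
      ∀ a : ℤ, a ≠ 0 → IsCoprime a (n : ℤ) →
        discrIdeal ℤ ℚ (kummerAlgebra ℚ n (a : ℚ)) =
            (∏ p ∈ a.natAbs.primeFactors,
                Ideal.span {(p : ℤ)} ^ (n - Nat.gcd (padicValInt p a) n)) *
              ∏ p ∈ n.primeFactors, Ideal.span {(p : ℤ)} ^ e a p ∧
        (Squarefree a →
          discrIdeal ℤ ℚ (kummerAlgebra ℚ n (a : ℚ)) =
            Ideal.span {a} ^ (n - 1) * ∏ p ∈ n.primeFactors, Ideal.span {(p : ℤ)} ^ e a p) ∧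
        (Squarefree a → a ≠ 1 → a ≠ -1 → IsField (kummerAlgebra ℚ n (a : ℚ)))) := by
  refine ⟨fun K _ _ => exists_discrIdeal_kummerAlgebra_eq (𝓞 K) K
    (NumberField.RingOfIntegers.not_isField K) hn, ?_⟩
  obtain ⟨B, hB, e, he, hD⟩ := exists_discrIdeal_kummerAlgebra_int_eq hn
  refine ⟨B, hB, e, he, fun a ha hcop => ⟨hD a ha hcop, fun hsq => ?_, fun hsq h1 h2 => ?_⟩⟩
  · rw [hD a ha hcop, prod_primeFactors_span_of_squarefree hsq]
  · have : Fact (Irreducible (X ^ n - C (a : ℚ) : ℚ[X])) :=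
      ⟨irreducible_X_pow_sub_C_of_squarefree hn hsq h1 h2⟩
    exact Field.toIsField _
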